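/- Let $G$ be a parent graph on the ordered nodes $V=(1,\dots,d)$: a directed acyclic graph in which the set $\mathrm{par}_i$ of parents of node $i$ (the nodes $j$ with an arrow $i\leftarrow j$) satisfies $\mathrm{par}_i\subseteq\{i+1,\dots,d\}$. Let $V$ be partitioned into $M,\alpha,\beta,C$, and put $a=\alpha\cup M$, $b=V\setminus a=\beta\cup C$. A node $j$ is an $a$-line ancestor of $i$ if there is a direction-preserving path $i\leftarrow t_1\leftarrow\cdots\leftarrow t_n\leftarrow j$ in $G$ ($n\ge 0$) with $t_1,\dots,t_n\in a$. The partial ancestor graph $G_{\mathrm{anc}}^{V,a}$ is the directed graph on $V$ with an arrow $i\leftarrow j$ if and only if $j$ is an $a$-line ancestor of $i$. A path in it is a sequence of distinct nodes, at least two, in which consecutive nodes are joined by an arrow of either direction. A path between $i$ and $j$ is active if it is a single edge, or if it has at least one inner node, the direction of the arrows changes at each inner node (so that every inner node $t$ is either a source, $\leftarrow t\rightarrow$, or a collision node, $\rightarrow t\leftarrow$), every inner source node is in $a$ and every inner collision node is in $b$. For each $i$ let $Y_i$ take values in a standard Borel space equipped with a $\sigma$-finite measure $\mu_i$, and let $Y=(Y_1,\dots,Y_d)$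 have a joint density, with respect to $\mu_1\otimes\cdots\otimes\mu_d$, of the form $$f_V(y)=\prod_{i=1}^d f_{i\mid \mathrm{par}_i}(y_i\mid y_{\mathrm{par}_i}),$$ where each $f_{i\mid \mathrm{par}_i}\ge 0$ is a measurable conditional density, $\int f_{i\mid\mathrm{par}_i}(y_i\mid y_{\mathrm{par}_i})\,d\mu_i(y_i)=1$ for all $y_{\mathrm{par}_i}$. If $G_{\mathrm{anc}}^{V,a}$ has no active path between $\alpha$ and $\beta$, that is, none between a node of $\alpha$ and a node of $\beta$, then $\alpha\perp\!\!\!\perp\beta\mid C$: the vectors $Y_\alpha$ and $Y_\beta$ are conditionally independent given $Y_C$. This holds for every such density, in particular for every joint density generated over $G$. -/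

import Mathlib

open MeasureTheory ProbabilityTheory
open scoped ENNReal

/-- A parent graph: a directed acyclic graph on the ordered nodes `Fin d`, in which the parents
of a node `i` (the nodes `j` with an arrow `i ← j`) all come later in the ordering. -/
structure ParentGraph (d : ℕ) where
  /-- the set of parents of a node -/
  par : Fin d → Finset (Fin d)
  lt_of_mem_par : ∀ {i j : Fin d}, j ∈ par i → i < j

/-- A path between `i` and `j` in a directed graph: a sequence of distinct nodes from `i` to `j`,
with at least one edge, consecutive nodes being coupled by an arrow of either direction. -/
def IsPathBetween {V : Type*} (H : Digraph V) (i j : V) (p : List V) : Prop :=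
  2 ≤ p.length ∧ p.Nodup ∧ p.IsChain (fun x y => H.Adj x y ∨ H.Adj y x) ∧
    p.head? = some i ∧ p.getLast? = some j

/-- `x ← t → y`. -/
def IsSourceAt {V : Type*} (H : Digraph V) (x t y : V) : Prop :=
  H.Adj t x ∧ H.Adj t y

/-- `x → t ← y`. -/
def IsCollisionAt {V : Type*} (H : Digraph V) (x t y : V) : Prop :=
  H.Adj x t ∧ H.Adj y t

/-- A path is alternating if it has at least one inner node and the direction of the arrows
changes at each inner node. The inner nodes are the middle nodes `t` of the consecutive
triples `x, t, y` of the path. -/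
def IsAlternating {V : Type*} (H : Digraph V) (p : List V) : Prop :=
  3 ≤ p.length ∧ ∀ x t y : V, [x, t, y] <:+: p → IsSourceAt H x t y ∨ IsCollisionAt H x t y

/-- An active path between `i` and `j`, with respect to the node set `a` and its complement `b`:
an edge, or an alternating path with every inner collision node in `b` and every inner source
node in `a`. -/
def IsActivePath {V : Type*} (H : Digraph V) (a : Set V) (i j : V) (p : List V) : Prop :=
  IsPathBetween H i j p ∧
    (p.length = 2 ∨
      (IsAlternating H p ∧ ∀ x t y : V, [x, t, y] <:+: p →
        (IsCollisionAt H x t y → t ∉ a) ∧ (IsSourceAt H x t y → t ∈ a)))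

namespace ParentGraph

variable {d : ℕ}

/-- `G.IsLineAncestor a i j`: node `j` is an `a`-line ancestor of node `i`, that is, there is a
direction-preserving path `i ← t₁ ← ⋯ ← tₙ ← j` (`n ≥ 0`) whose inner nodes are all in `a`. -/
inductive IsLineAncestor (G : ParentGraph d) (a : Set (Fin d)) : Fin d → Fin d → Prop
  | parent {i j : Fin d} : j ∈ G.par i → IsLineAncestor G a i j
  | step {i t j : Fin d} : t ∈ G.par i → t ∈ a → IsLineAncestor G a t j → IsLineAncestor G a i j

/-- The partial ancestor graph with respect to `a`: there is an arrow `i ← j` if and only if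
`j` is an `a`-line ancestor of `i` in the parent graph. -/
def partialAncestorGraph (G : ParentGraph d) (a : Set (Fin d)) : Digraph (Fin d) where
  Adj j i := G.IsLineAncestor a i j

/-- The function `f` is a joint density, with respect to the product of the measures `μ i`,
obtained by the stepwise process over the parent graph:
`f y = ∏ i, k i (y i | y_{par i})`, where each `k i` is a conditional density
of the variable at `i` given those at the parents of `i`. -/
def Factorizes (G : ParentGraph d) {𝓨 : Fin d → Type*} [∀ i, MeasurableSpace (𝓨 i)]
    (μ : ∀ i, Measure (𝓨 i)) (f : (∀ i, 𝓨 i) → ℝ≥0∞) : Prop :=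
  ∃ k : ∀ i, 𝓨 i → (∀ j : G.par i, 𝓨 j) → ℝ≥0∞,
    (∀ i, Measurable (Function.uncurry (k i))) ∧
    (∀ i z, ∫⁻ x, k i x z ∂(μ i) = 1) ∧
    ∀ y, f y = ∏ i, k i (y i) ((G.par i).restrict y)

end ParentGraph

/-- `α ⊥⊥ β | C` under the joint distribution `P` of the coordinate variables: the subvectors
indexed by `α` and `β` are conditionally independent given the subvector indexed by `C`. -/
def CondIndepGiven {ι : Type*} [Countable ι] {𝓨 : ι → Type*} [∀ i, MeasurableSpace (𝓨 i)]
    [∀ i, StandardBorelSpace (𝓨 i)] (P : Measure (∀ i, 𝓨 i)) [IsFiniteMeasure P]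
    (α β C : Finset ι) : Prop :=
  CondIndepFun (MeasurableSpace.comap (C.restrict (π := 𝓨)) inferInstance)
    (Finset.measurable_restrict C).comap_le (α.restrict (π := 𝓨)) (β.restrict (π := 𝓨)) P

/-!
The nodes `N ⊆ M` all of whose descendants lie in `M` are integrated out first: their conditional
densities contribute the factor one (`ParentGraph.lmarginal_prod_eq_one`). The density of the other
coordinates is the product of the remaining conditional densities, and it suffices to write it as a
product of a function of `S ∪ C` and a function of `T ∪ C`, where `S ⊇ α` and `T ⊇ β` partition the
remaining nodes outside `C` (`condIndepGiven_of_eq_mul_mul`).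

To find `S`, call a node connected to `α` if a walk in the partial ancestor graph leads to it from
`α` whose nodes in `a` are sources and whose nodes outside `a` are collision nodes, except that the
starting node in `α` may be entered by an arrow. Let `S` be the set of nodes of `a` outside `N`
that are connected to `α`. If `s ∈ a` has an arrow to `t ∉ a`, then `s` is connected to `α` exactly
when `t` is; and if it has an arrow to a node of `α`, it is connected to `α`. A walk that reaches
`β`, or that reaches a collision node and is extended by an arrow from `β` into it, can be cut down
to an active path between `α` and `β` (`exists_isActivePath_of_reachable`), and a single arrow
between `α` and `β` is one. So no node of `β` is connected to `α`, and none has an arrow to a node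
of `α` or to a node outside `a` connected to `α`. A node of `M` outside `N` is a
line ancestor of some node outside `M`, and so are its parents. Hence a node outside `N` and
its parents outside `C` are either all connected to `α` or all not, which is the required splitting
of the factors.

For the measure theory, let `A` be an event in the `α`-coordinates. The ratio `q` of the integrals
over the `S`-coordinates of the `S ∪ C`-factor, taken over `A` and without restriction, is a
function of the `C`-coordinates, and Tonelli's theorem shows that it is a conditional probability
of `A` given the coordinates in `β` and `C`; that it depends on `C` alone is the conditional
independence (`condExp_indicator_inter_eq_mul`).
-/

/-! ### Active paths from reachability -/

section ActivePaths

variable {V : Type*} (H : Digraph V) (a : Set V)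

/-- The undirected graph on `V` that keeps an arrow `s → t` of `H` exactly when `s ∈ a` and
`t ∉ a`. Every node of `a` is then a source, and every other node a collision node, on each
walk in this graph, so its walks are the alternating ones allowed inside an active path. -/
def alternatingGraph : SimpleGraph V where
  Adj x y := (x ∈ a ∧ y ∉ a ∧ H.Adj x y) ∨ (y ∈ a ∧ x ∉ a ∧ H.Adj y x)
  symm := ⟨fun _ _ h => h.symm⟩
  loopless := ⟨fun x h => by rcases h with h | h <;> exact h.2.1 h.1⟩

/-- The edge between `t` and `x` leaves `t` if `t ∈ a` and enters `t` otherwise: the direction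
it must have on an active path with `t` as an inner node. -/
def PointsProperly (t x : V) : Prop :=
  (t ∈ a ∧ H.Adj t x) ∨ (t ∉ a ∧ H.Adj x t)

variable {H a}

lemma infix_triple {x t y : V} {p : List V} (h : [x, t, y] <:+: p) :
    [x, t] <:+: p.dropLast ∧ [t, y] <:+: p.tail := by
  obtain ⟨u, v, rfl⟩ := h
  constructor
  · have : u ++ [x, t, y] ++ v = (u ++ [x, t]) ++ (y :: v) := by simp
    rw [this, List.dropLast_append_of_ne_nil (by simp)]
    exact ⟨u, (y :: v).dropLast, rfl⟩
  · cases u with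
    | nil => exact ⟨[], v, by simp⟩
    | cons c u => exact ⟨u ++ [x], v, by simp⟩

lemma isActivePath_of_pointsProperly (hH : ∀ x y, H.Adj x y → ¬ H.Adj y x) {i j : V} {p : List V}
    (hij : i ≠ j) (hnodup : p.Nodup) (hhead : p.head? = some i) (hlast : p.getLast? = some j)
    (hchain : p.IsChain (fun x y => H.Adj x y ∨ H.Adj y x))
    (hl : p.dropLast.IsChain (fun x t => PointsProperly H a t x))
    (hr : p.tail.IsChain (PointsProperly H a)) :
    IsActivePath H a i j p := by
  have key : ∀ x t y : V, [x, t, y] <:+: p →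
      PointsProperly H a t x ∧ PointsProperly H a t y := fun x t y h => by
    have h1 := hl.infix (infix_triple h).1
    have h2 := hr.infix (infix_triple h).2
    simp only [List.isChain_cons_cons] at h1 h2
    exact ⟨h1.1, h2.1⟩
  have hlen : 2 ≤ p.length := by
    match p, hhead, hlast with
    | [x], h1, h2 => simp at h1 h2; exact absurd (h1.symm.trans h2) hij
    | x :: y :: l, _, _ => simp
  refine ⟨⟨hlen, hnodup, hchain, hhead, hlast⟩, ?_⟩
  rcases hlen.eq_or_lt with h | h
  · exact Or.inl h.symm
  refine Or.inr ⟨⟨h, fun x t y hp => ?_⟩, fun x t y hp => ⟨fun hc => ?_, fun hs => ?_⟩⟩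
  · obtain ⟨⟨h1, h2⟩ | ⟨h1, h2⟩, ⟨h3, h4⟩ | ⟨h3, h4⟩⟩ := key x t y hp
    exacts [Or.inl ⟨h2, h4⟩, absurd h1 h3, absurd h3 h1, Or.inr ⟨h2, h4⟩]
  · rcases (key x t y hp).1 with ⟨_, h2⟩ | ⟨h1, _⟩
    exacts [absurd h2 (hH _ _ hc.1), h1]
  · rcases (key x t y hp).1 with ⟨h1, _⟩ | ⟨_, h2⟩
    exacts [h1, absurd h2 (hH _ _ hs.1)]

lemma alternatingGraph_adj {x y : V} (h : (alternatingGraph H a).Adj x y) :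
    (H.Adj x y ∨ H.Adj y x) ∧ PointsProperly H a x y ∧ PointsProperly H a y x := by
  simp only [alternatingGraph, PointsProperly] at h ⊢
  tauto

/-- A walk of `alternatingGraph H a` gives an active path from `i` to `j` if its first node is
`i` or a source in `a` with an arrow to `i`, and its last node is `j` or a collision node outside
`a` with an arrow from `j`. -/
lemma exists_isActivePath_of_reachable (hH : ∀ x y, H.Adj x y → ¬ H.Adj y x) {i j s t : V}
    (hij : i ≠ j) (hs : s = i ∨ s ∈ a ∧ H.Adj s i) (ht : t = j ∨ t ∉ a ∧ H.Adj j t)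
    (hreach : (alternatingGraph H a).Reachable s t) :
    ∃ p : List V, IsActivePath H a i j p := by
  classical
  obtain ⟨w, hw⟩ := hreach.exists_isPath
  -- If `i` lies on the walk, the walk is started there instead.
  obtain ⟨s, w, hw, hs⟩ : ∃ (s : V) (w : (alternatingGraph H a).Walk s t), w.IsPath ∧
      (s = i ∨ (i ∉ w.support ∧ s ∈ a ∧ H.Adj s i)) := by
    by_cases hi : i ∈ w.support
    · exact ⟨i, w.dropUntil i hi, hw.dropUntil hi, Or.inl rfl⟩
    · refine ⟨s, w, hw, hs.imp_right fun h => ⟨hi, h⟩⟩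
  -- Likewise the walk is stopped at `j`.
  obtain ⟨t, w, hw, hs, ht⟩ : ∃ (t : V) (w : (alternatingGraph H a).Walk s t), w.IsPath ∧
      (s = i ∨ (i ∉ w.support ∧ s ∈ a ∧ H.Adj s i)) ∧
      (t = j ∨ (j ∉ w.support ∧ t ∉ a ∧ H.Adj j t)) := by
    by_cases hj : j ∈ w.support
    · refine ⟨j, w.takeUntil j hj, hw.takeUntil hj, ?_, Or.inl rfl⟩
      exact hs.imp_right fun h =>
        ⟨fun hi => h.1 (w.support_takeUntil_subset_support hj hi), h.2⟩
    · exact ⟨t, w, hw, hs, ht.imp_right fun h => ⟨hj, h⟩⟩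
  have hc := w.isChain_adj_support
  have hn := hw.support_nodup
  have hh : w.support.head? = some s := by
    rw [List.head?_eq_some_head w.support_ne_nil, w.head_support]
  have hl : w.support.getLast? = some t := by
    rw [List.getLast?_eq_some_getLast w.support_ne_nil, w.getLast_support]
  generalize w.support = l at hs ht hc hn hh hl
  have hc1 := hc.imp fun x y h => (alternatingGraph_adj h).1
  have hc2 := hc.imp fun x y h => (alternatingGraph_adj h).2.1
  have hc3 := hc.imp fun x y h => (alternatingGraph_adj h).2.2
  have hne : l ≠ [] := by rintro rfl; simp at hh
  -- The walk is extended by `i` in front, unless it already starts there.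
  obtain ⟨l, hn, hh, hl, hne, hc1, hc2, hc3, ht⟩ : ∃ l : List V, l.Nodup ∧ l.head? = some i ∧
      l.getLast? = some t ∧ l ≠ [] ∧ l.IsChain (fun x y => H.Adj x y ∨ H.Adj y x) ∧
      l.tail.IsChain (PointsProperly H a) ∧ l.IsChain (fun x t => PointsProperly H a t x) ∧
      (t = j ∨ (j ∉ l ∧ t ∉ a ∧ H.Adj j t)) := by
    rcases hs with rfl | ⟨hi, hsa, hadj⟩
    · exact ⟨l, hn, hh, hl, hne, hc1, hc2.tail, hc3, ht⟩
    · refine ⟨i :: l, List.nodup_cons.2 ⟨hi, hn⟩, rfl, ?_, by simp, ?_, hc2, ?_, ?_⟩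
      · rw [List.getLast?_cons, hl]; rfl
      · refine List.isChain_cons.2 ⟨fun y hy => ?_, hc1⟩
        rw [hh] at hy; obtain rfl : s = y := by simpa using hy
        exact Or.inr hadj
      · refine List.isChain_cons.2 ⟨fun y hy => ?_, hc3⟩
        rw [hh] at hy; obtain rfl : s = y := by simpa using hy
        exact Or.inl ⟨hsa, hadj⟩
      · refine ht.imp_right fun h => ⟨?_, h.2⟩
        simp only [List.mem_cons, not_or]
        exact ⟨hij.symm, h.1⟩
  rcases ht with rfl | ⟨hj, hta, hadj⟩
  · exact ⟨l, isActivePath_of_pointsProperly hH hij hn hh hl hc1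
      (hc3.prefix l.dropLast_prefix) hc2⟩
  · refine ⟨l ++ [j], isActivePath_of_pointsProperly hH hij ?_ ?_ ?_ ?_ ?_ ?_⟩
    · exact List.nodup_append.2 ⟨hn, by simp, fun x hx y hy hxy =>
        hj (List.mem_singleton.1 hy ▸ hxy ▸ hx)⟩
    · rw [List.head?_append, hh]; rfl
    · simp
    · refine List.isChain_append.2 ⟨hc1, by simp, fun x hx y hy => ?_⟩
      rw [hl] at hx; obtain rfl : t = x := by simpa using hx
      obtain rfl : j = y := by simpa using hy
      exact Or.inr hadj
    · simpa using hc3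
    · rw [List.tail_append_of_ne_nil hne]
      refine List.isChain_append.2 ⟨hc2, by simp, fun x hx y hy => ?_⟩
      obtain rfl : j = y := by simpa using hy
      obtain rfl : x = t := by
        have : x ∈ l.getLast? := by
          match l, hx with
          | c :: [], hx => simp at hx
          | c :: e :: l, hx => simpa using hx
        rw [hl] at this; simpa using this.symm
      exact Or.inr ⟨hta, hadj⟩

end ActivePaths

/-! ### Conditional independence from a factorized density -/

/-- If the conditional probability of `s` given the σ-algebra `m` and the event `t` has a version
`q` that is `m`-measurable, then `s` and `t` are conditionally independent given `m`. -/
lemma condExp_indicator_inter_eq_mul {Ω : Type*} {m mΩ : MeasurableSpace Ω} (hm : m ≤ mΩ)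
    {P : Measure Ω} [IsFiniteMeasure P] {s t : Set Ω} (hs : MeasurableSet s)
    (ht : MeasurableSet t) {q : Ω → ℝ≥0∞} (hq : Measurable[m] q) (hq1 : ∀ ω, q ω ≤ 1)
    (h : ∀ D, MeasurableSet[m] D → P (s ∩ D) = ∫⁻ ω in D, q ω ∂P)
    (h' : ∀ D, MeasurableSet[m] D → P (s ∩ t ∩ D) = ∫⁻ ω in t ∩ D, q ω ∂P) :
    P⟦s ∩ t | m⟧ =ᵐ[P] fun ω => (P⟦s | m⟧) ω * (P⟦t | m⟧) ω := by
  have hqr : StronglyMeasurable[m] (fun ω => (q ω).toReal) :=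
    (hq.ennreal_toReal).stronglyMeasurable
  have hbound : ∀ ω, ‖(q ω).toReal‖ ≤ 1 := fun ω => by
    rw [Real.norm_of_nonneg ENNReal.toReal_nonneg]
    exact ENNReal.toReal_le_of_le_ofReal zero_le_one (by simpa using hq1 ω)
  have hqint : Integrable (fun ω => (q ω).toReal) P :=
    Integrable.of_bound (hqr.mono hm).aestronglyMeasurable 1 (ae_of_all _ hbound)
  have hind : ∀ {r : Set Ω}, MeasurableSet r → Integrable (r.indicator fun _ => (1 : ℝ)) P :=
    fun hr => (integrable_const 1).indicator hr
  have hint : ∀ D, ∫ ω in D, (q ω).toReal ∂P = (∫⁻ ω in D, q ω ∂P).toReal := fun D =>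
    integral_toReal (hq.mono hm le_rfl).aemeasurable
      (ae_of_all _ fun ω => (hq1 ω).trans_lt ENNReal.one_lt_top)
  have hset : ∀ {r : Set Ω}, MeasurableSet r → ∀ D,
      ∫ ω in D, r.indicator (fun _ => (1 : ℝ)) ω ∂P = (P (r ∩ D)).toReal := fun {r} hr D => by
    rw [integral_indicator hr, setIntegral_const]
    simp [measureReal_def, Measure.restrict_apply hr]
  have hA : (fun ω => (q ω).toReal) =ᵐ[P] P⟦s | m⟧ := by
    refine ae_eq_condExp_of_forall_setIntegral_eq hm (hind hs)
      (fun _ _ _ => hqint.integrableOn) (fun D hD _ => ?_) hqr.aestronglyMeasurable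
    rw [hint, hset hs, h D hD]
  have hmul : Integrable ((fun ω => (q ω).toReal) * t.indicator fun _ => (1 : ℝ)) P :=
    (hind ht).bdd_mul (hqr.mono hm).aestronglyMeasurable (ae_of_all _ hbound)
  have hB : P[(fun ω => (q ω).toReal) * t.indicator (fun _ => (1 : ℝ)) | m]
      =ᵐ[P] P⟦s ∩ t | m⟧ := by
    refine ae_eq_condExp_of_forall_setIntegral_eq hm (hind (hs.inter ht))
      (fun _ _ _ => integrable_condExp.integrableOn) (fun D hD _ => ?_)
      stronglyMeasurable_condExp.aestronglyMeasurable
    rw [setIntegral_condExp hm hmul hD, hset (hs.inter ht), h' D hD, ← hint]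
    have : ((fun ω => (q ω).toReal) * t.indicator fun _ => (1 : ℝ))
        = t.indicator fun ω => (q ω).toReal := by
      ext ω; by_cases hω : ω ∈ t <;> simp [hω]
    rw [this, integral_indicator ht, Measure.restrict_restrict ht]
  have hC := condExp_stronglyMeasurable_mul_of_bound hm hqr (hind ht) 1 (ae_of_all _ hbound)
  filter_upwards [hA, hB, hC] with ω h1 h2 h3
  rw [← h2, h3, ← h1]; rfl

section DependsOn

variable {ι : Type*} {X : ι → Type*}

lemma DependsOn.mul {f g : (∀ i, X i) → ℝ≥0∞} {s : Set ι} (hf : DependsOn f s)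
    (hg : DependsOn g s) : DependsOn (fun x => f x * g x) s :=
  fun _ _ h => congrArg₂ _ (hf h) (hg h)

lemma DependsOn.finset_prod {κ : Type*} {f : κ → (∀ i, X i) → ℝ≥0∞} {s : Set ι} (I : Finset κ)
    (hf : ∀ k ∈ I, DependsOn (f k) s) : DependsOn (fun x => ∏ k ∈ I, f k x) s :=
  fun _ _ h => Finset.prod_congr rfl fun k hk => hf k hk h

lemma dependsOn_indicator_preimage_restrict (s : Finset ι) (A : Set (∀ i : s, X i)) :
    DependsOn ((s.restrict ⁻¹' A).indicator (1 : (∀ i, X i) → ℝ≥0∞)) s := by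
  intro x y h
  have : s.restrict x = s.restrict y := by ext i; exact h i i.2
  by_cases hx : s.restrict x ∈ A
  · simp [hx, this ▸ hx]
  · simp [hx, this ▸ hx]

end DependsOn

section Marginals

variable {ι : Type*} [DecidableEq ι] {X : ι → Type*} [∀ i, MeasurableSpace (X i)]
  {μ : ∀ i, Measure (X i)}

lemma lmarginal_mul_of_dependsOn {s t : Finset ι} (hst : Disjoint s t)
    {g f : (∀ i, X i) → ℝ≥0∞} (hg : DependsOn g t) (hf : Measurable f) :
    ∫⋯∫⁻_s, (fun y => g y * f y) ∂μ = fun x => g x * (∫⋯∫⁻_s, f ∂μ) x := by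
  ext x
  have : ∀ y : ∀ i : s, X i, g (Function.updateFinset x s y) = g x := fun y =>
    hg fun i hi => by
      simp [Function.updateFinset, Finset.disjoint_right.1 hst (Finset.mem_coe.1 hi)]
  simp only [lmarginal, this]
  exact lintegral_const_mul _ (hf.comp measurable_updateFinset)

lemma dependsOn_lmarginal {s t : Finset ι} {f : (∀ i, X i) → ℝ≥0∞}
    (hf : DependsOn f ↑(s ∪ t)) : DependsOn (∫⋯∫⁻_s, f ∂μ) t := by
  intro x y hxy
  simp only [lmarginal]
  refine lintegral_congr fun z => hf fun i hi => ?_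
  by_cases his : i ∈ s
  · simp [Function.updateFinset, his]
  · simp only [Function.updateFinset, his, dite_false]
    exact hxy i (by simpa [his] using hi)

/-- A function of the `s`-coordinates is measurable with respect to the σ-algebra that they
generate. -/
lemma DependsOn.measurable_comap_restrict {f : (∀ i, X i) → ℝ≥0∞} {s : Finset ι}
    (hf : DependsOn f s) (hfm : Measurable f) :
    Measurable[MeasurableSpace.comap (s.restrict (π := X)) inferInstance] f := by
  rcases isEmpty_or_nonempty (∀ i, X i) with h | ⟨⟨x⟩⟩
  · rw [Subsingleton.elim f fun _ => 0]
    exact measurable_const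
  have : f = (fun z => f (Function.updateFinset x s z)) ∘ s.restrict := by
    ext y
    refine hf fun i hi => ?_
    simp [Function.updateFinset, Finset.mem_coe.1 hi]
  rw [this]
  exact (hfm.comp measurable_updateFinset).comp (comap_measurable _)

/-- Tonelli's theorem for a product of functions that interact through the coordinates in `C`
only: with `C` fixed, the integral over `S ∪ T` splits. -/
lemma lintegral_pi_eq_lmarginal_mul_mul [Fintype ι] [∀ i, SigmaFinite (μ i)]
    {S T C N : Finset ι} (hcover : C ∪ (T ∪ (S ∪ N)) = Finset.univ) (hSN : Disjoint S N)
    (hT : Disjoint T (S ∪ N)) (hC : Disjoint C (T ∪ (S ∪ N)))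
    {u Φ Ψ Ω : (∀ i, X i) → ℝ≥0∞} (hu : DependsOn u C) (hΦ : DependsOn Φ ↑(S ∪ C))
    (hΨ : DependsOn Ψ ↑(T ∪ C)) (hum : Measurable u) (hΦm : Measurable Φ) (hΨm : Measurable Ψ)
    (hΩm : Measurable Ω) (hΩ : ∀ x, (∫⋯∫⁻_N, Ω ∂μ) x = 1) (x : ∀ i, X i) :
    ∫⁻ y, u y * Φ y * Ψ y * Ω y ∂(Measure.pi μ)
      = (∫⋯∫⁻_C, (fun y => u y * (∫⋯∫⁻_S, Φ ∂μ) y * (∫⋯∫⁻_T, Ψ ∂μ) y) ∂μ) x := by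
  simp only [Finset.disjoint_union_right] at hT hC
  have hΦ' : DependsOn (∫⋯∫⁻_S, Φ ∂μ) C := dependsOn_lmarginal hΦ
  rw [lintegral_eq_lmarginal_univ x, ← hcover,
    lmarginal_union μ _ (by fun_prop) (by simp [Finset.disjoint_union_right, hC]),
    lmarginal_union μ _ (by fun_prop) (by simp [Finset.disjoint_union_right, hT]),
    lmarginal_union μ _ (by fun_prop) hSN]
  have h1 : ∫⋯∫⁻_N, (fun y => u y * Φ y * Ψ y * Ω y) ∂μ = fun y => u y * Ψ y * Φ y := by
    rw [lmarginal_mul_of_dependsOn (t := C ∪ (T ∪ S)) _ _ hΩm]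
    · ext y; rw [hΩ, mul_one, mul_right_comm]
    · simp [Finset.disjoint_union_right, hC.2.2.symm, hT.2.symm, hSN.symm]
    · refine ((hu.mono ?_).mul (hΦ.mono ?_)).mul (hΨ.mono ?_) <;>
      · intro i; simp only [Finset.mem_coe, Finset.mem_union]; tauto
  have h2 : ∫⋯∫⁻_S, (fun y => u y * Ψ y * Φ y) ∂μ
      = fun y => u y * (∫⋯∫⁻_S, Φ ∂μ) y * Ψ y := by
    rw [lmarginal_mul_of_dependsOn (t := T ∪ C) _ _ hΦm]
    · ext y; rw [mul_right_comm]
    · simp [Finset.disjoint_union_right, hC.2.1.symm, hT.1.symm]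
    · refine (hu.mono ?_).mul hΨ
      intro i; simp only [Finset.mem_coe, Finset.mem_union]; tauto
  rw [h1, h2, lmarginal_mul_of_dependsOn hC.1.symm (hu.mul hΦ') hΨm]

end Marginals

/-- Cancelling `p'` is also legitimate where it is infinite, since `r` then vanishes. -/
lemma ENNReal.div_mul_mul_eq_mul {p p' r r' : ℝ≥0∞} (hp : p ≤ p') (hr : r ≤ r')
    (h : p' * r' ≠ ∞) : p / p' * p' * r = p * r := by
  rcases eq_or_ne p' 0 with rfl | h0
  · simp [nonpos_iff_eq_zero.1 hp]
  rcases eq_or_ne p' ∞ with rfl | ht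
  · rcases eq_or_ne r' 0 with rfl | hr0
    · simp [nonpos_iff_eq_zero.1 hr]
    · exact absurd (ENNReal.top_mul hr0) h
  · rw [ENNReal.div_mul_cancel h0 ht]

/-- A density that splits into a factor in the coordinates `S ∪ C`, a factor in the coordinates
`T ∪ C` and a factor that integrates to one over the remaining coordinates `N` makes the
coordinates in `S` and those in `T` conditionally independent given those in `C`. -/
theorem condIndepGiven_of_eq_mul_mul {ι : Type*} [DecidableEq ι] [Fintype ι] {X : ι → Type*}
    [∀ i, MeasurableSpace (X i)] [∀ i, StandardBorelSpace (X i)] {μ : ∀ i, Measure (X i)}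
    [∀ i, SigmaFinite (μ i)] {α β S T C N : Finset ι}
    (hcover : C ∪ (T ∪ (S ∪ N)) = Finset.univ) (hSN : Disjoint S N)
    (hT : Disjoint T (S ∪ N)) (hC : Disjoint C (T ∪ (S ∪ N))) (hα : α ⊆ S) (hβ : β ⊆ T)
    {Φ Ψ Ω : (∀ i, X i) → ℝ≥0∞} (hΦ : DependsOn Φ ↑(S ∪ C))
    (hΨ : DependsOn Ψ ↑(T ∪ C)) (hΦm : Measurable Φ) (hΨm : Measurable Ψ)
    (hΩm : Measurable Ω) (hΩ : ∀ x, (∫⋯∫⁻_N, Ω ∂μ) x = 1)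
    (P : Measure (∀ i, X i)) [IsProbabilityMeasure P]
    (hP : P = (Measure.pi μ).withDensity fun y => Φ y * Ψ y * Ω y) :
    CondIndepGiven P α β C := by
  obtain ⟨x⟩ : Nonempty (∀ i, X i) := nonempty_of_isProbabilityMeasure P
  unfold CondIndepGiven
  rw [condIndepFun_iff_condExp_inter_preimage_eq_mul (Finset.measurable_restrict α)
    (Finset.measurable_restrict β)]
  intro A B hA hB
  replace hA := Finset.measurable_restrict (X := X) α hA
  have hsub : ∀ {r : Finset ι} {U : Finset ι}, r ⊆ U → (r : Set ι) ⊆ ↑(U ∪ C) := fun h i hi => by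
    simp [h (Finset.mem_coe.1 hi)]
  have hle : ∀ (E : Set (∀ i, X i)) (F : (∀ i, X i) → ℝ≥0∞) y,
      E.indicator (1 : (∀ i, X i) → ℝ≥0∞) y * F y ≤ F y := fun E F y => by
    by_cases hy : y ∈ E <;> simp [hy]
  -- The ratio `q` of the integrals of `ΦA` and `Φ` over the `S`-coordinates is a version of the
  -- conditional probability of the event `A'` given `C`, and also given `β` and `C`.
  set A' : Set (∀ i, X i) := α.restrict ⁻¹' A
  let ΦA : (∀ i, X i) → ℝ≥0∞ := fun y => A'.indicator 1 y * Φ y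
  have hΦAm : Measurable ΦA := (measurable_one.indicator hA).mul hΦm
  have hΦA : DependsOn ΦA ↑(S ∪ C) :=
    ((dependsOn_indicator_preimage_restrict α A).mono (hsub hα)).mul hΦ
  let q : (∀ i, X i) → ℝ≥0∞ := fun y => (∫⋯∫⁻_S, ΦA ∂μ) y / (∫⋯∫⁻_S, Φ ∂μ) y
  have hqm : Measurable q := (hΦAm.lmarginal μ).div (hΦm.lmarginal μ)
  have hqd : DependsOn q C := fun y z h => by
    simp only [q, dependsOn_lmarginal (μ := μ) hΦA h, dependsOn_lmarginal (μ := μ) hΦ h]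
  have hΦle : ∀ y, (∫⋯∫⁻_S, ΦA ∂μ) y ≤ (∫⋯∫⁻_S, Φ ∂μ) y := lmarginal_mono (hle A' Φ)
  have hq1 : ∀ y, q y ≤ 1 := fun y =>
    (ENNReal.div_le_div_right (hΦle y) _).trans ENNReal.div_self_le_one
  have hPint : ∀ F : (∀ i, X i) → ℝ≥0∞, Measurable F →
      ∫⁻ y, F y ∂P = ∫⁻ y, Φ y * Ψ y * Ω y * F y ∂(Measure.pi μ) := fun F hF => by
    rw [hP, lintegral_withDensity_eq_lintegral_mul _ (by fun_prop) hF]; rfl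
  -- The weights given `C` are finite almost everywhere, although each factor may be infinite.
  have hfin : ∀ᵐ z ∂(Measure.pi fun i : C => μ i),
      (∫⋯∫⁻_S, Φ ∂μ) (Function.updateFinset x C z) *
        (∫⋯∫⁻_T, Ψ ∂μ) (Function.updateFinset x C z) < ∞ := by
    refine ae_lt_top (((hΦm.lmarginal μ).mul (hΨm.lmarginal μ)).comp measurable_updateFinset) ?_
    have h1 := lintegral_pi_eq_lmarginal_mul_mul hcover hSN hT hC (u := fun _ => 1)
      ((dependsOn_const 1).mono (Set.empty_subset _)) hΦ hΨ measurable_const hΦm hΨm hΩm hΩ x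
    have h2 := hPint (fun _ => 1) measurable_const
    simp only [one_mul] at h1
    simp only [mul_one, lintegral_one, measure_univ] at h2
    rw [← h2] at h1
    change (∫⋯∫⁻_C, (fun y => (∫⋯∫⁻_S, Φ ∂μ) y * (∫⋯∫⁻_T, Ψ ∂μ) y) ∂μ) x ≠ ∞
    rw [← h1]; exact ENNReal.one_ne_top
  have key : ∀ B : Set (∀ i : β, X i), MeasurableSet B → ∀ D,
      MeasurableSet[MeasurableSpace.comap (C.restrict (π := X)) inferInstance] D →
      P (A' ∩ β.restrict ⁻¹' B ∩ D) = ∫⁻ y in β.restrict ⁻¹' B ∩ D, q y ∂P := by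
    rintro B hB _ ⟨E, hE, rfl⟩
    replace hB := Finset.measurable_restrict (X := X) β hB
    replace hE := Finset.measurable_restrict (X := X) C hE
    have hEd := dependsOn_indicator_preimage_restrict (X := X) C E
    set B' : Set (∀ i, X i) := β.restrict ⁻¹' B
    set D : Set (∀ i, X i) := C.restrict ⁻¹' E
    let ΨB : (∀ i, X i) → ℝ≥0∞ := fun y => B'.indicator 1 y * Ψ y
    have hΨBm : Measurable ΨB := (measurable_one.indicator hB).mul hΨm
    have hΨB : DependsOn ΨB ↑(T ∪ C) :=
      ((dependsOn_indicator_preimage_restrict β B).mono (hsub hβ)).mul hΨ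
    have hDm : Measurable (D.indicator (1 : (∀ i, X i) → ℝ≥0∞)) := measurable_one.indicator hE
    have hABm := (hA.inter hB).inter hE
    rw [← lintegral_indicator_one hABm, hPint _ (measurable_one.indicator hABm),
      ← lintegral_indicator (hB.inter hE), hPint _ (hqm.indicator (hB.inter hE))]
    have e1 : ∀ y, Φ y * Ψ y * Ω y * (A' ∩ B' ∩ D).indicator 1 y
        = D.indicator 1 y * ΦA y * ΨB y * Ω y := fun y => by
      by_cases h1 : y ∈ A' <;> by_cases h2 : y ∈ B' <;> by_cases h3 : y ∈ D <;>
        simp [ΦA, ΨB, h1, h2, h3]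
    have e2 : ∀ y, Φ y * Ψ y * Ω y * (B' ∩ D).indicator q y
        = (D.indicator 1 y * q y) * Φ y * ΨB y * Ω y := fun y => by
      by_cases h2 : y ∈ B' <;> by_cases h3 : y ∈ D <;> simp [ΨB, h2, h3]
      ring
    simp only [e1, e2]
    rw [lintegral_pi_eq_lmarginal_mul_mul hcover hSN hT hC hEd hΦA hΨB hDm hΦAm hΨBm hΩm hΩ x,
      lintegral_pi_eq_lmarginal_mul_mul hcover hSN hT hC (u := fun y => D.indicator 1 y * q y)
        (hEd.mul hqd) hΦ hΨB (hDm.mul hqm) hΦm hΨBm hΩm hΩ x]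
    refine lintegral_congr_ae (hfin.mono fun z hz => ?_)
    simp only [mul_assoc]
    rw [← mul_assoc (q _), ENNReal.div_mul_mul_eq_mul (hΦle _)
      (lmarginal_mono (hle B' Ψ) _) hz.ne]
  refine condExp_indicator_inter_eq_mul (Finset.measurable_restrict C).comap_le hA
    (Finset.measurable_restrict β hB) (hqd.measurable_comap_restrict hqm) hq1 (fun D hD => ?_)
    (key B hB)
  simpa using key Set.univ MeasurableSet.univ D hD

/-! ### The partial ancestor graph and the factorization -/

namespace ParentGraph

variable {d : ℕ} {G : ParentGraph d} {a : Set (Fin d)}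

lemma IsLineAncestor.lt {i j : Fin d} (h : G.IsLineAncestor a i j) : i < j := by
  induction h with
  | parent h => exact G.lt_of_mem_par h
  | step h _ _ ih => exact (G.lt_of_mem_par h).trans ih

/-- A parent of a node in `a` is an `a`-line ancestor of everything that node is one of. -/
lemma IsLineAncestor.of_mem_par {i s t : Fin d} (h : G.IsLineAncestor a t s) (hs : s ∈ a)
    (hi : i ∈ G.par s) : G.IsLineAncestor a t i := by
  induction h with
  | parent h => exact .step h hs (.parent hi)
  | step h ht _ ih => exact .step h ht (ih hs hi)

variable (G a) in
/-- The node `v` is connected to `α` by a walk that could be the beginning of an active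
path: a walk of the alternating graph that starts in `α`, or at a source in `a` with an arrow to a
node of `α`. -/
def IsConnectedTo (α : Finset (Fin d)) (v : Fin d) : Prop :=
  ∃ i ∈ α, ∃ s, (s = i ∨ s ∈ a ∧ (G.partialAncestorGraph a).Adj s i) ∧
    (alternatingGraph (G.partialAncestorGraph a) a).Reachable s v

lemma isConnectedTo_iff_of_isLineAncestor {α : Finset (Fin d)} {s t : Fin d} (hs : s ∈ a)
    (ht : t ∉ a) (h : G.IsLineAncestor a t s) :
    G.IsConnectedTo a α s ↔ G.IsConnectedTo a α t := by
  have hadj : (alternatingGraph (G.partialAncestorGraph a) a).Adj s t := Or.inl ⟨hs, ht, h⟩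
  constructor
  · rintro ⟨i, hi, r, hr, hreach⟩
    exact ⟨i, hi, r, hr, hreach.trans hadj.reachable⟩
  · rintro ⟨i, hi, r, hr, hreach⟩
    exact ⟨i, hi, r, hr, hreach.trans hadj.symm.reachable⟩

lemma isConnectedTo_of_isLineAncestor {α : Finset (Fin d)} {s i : Fin d} (hs : s ∈ a)
    (hi : i ∈ α) (h : G.IsLineAncestor a i s) : G.IsConnectedTo a α s :=
  ⟨i, hi, s, Or.inr ⟨hs, h⟩, .rfl⟩

lemma isConnectedTo_self {α : Finset (Fin d)} {i : Fin d} (hi : i ∈ α) :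
    G.IsConnectedTo a α i :=
  ⟨i, hi, i, Or.inl rfl, .rfl⟩

lemma exists_isActivePath_of_isConnectedTo {α : Finset (Fin d)} {t j : Fin d}
    (h : G.IsConnectedTo a α t) (hj : j ∉ α)
    (ht : t = j ∨ t ∉ a ∧ G.IsLineAncestor a t j) :
    ∃ i ∈ α, ∃ p : List (Fin d), IsActivePath (G.partialAncestorGraph a) a i j p := by
  obtain ⟨i, hi, s, hs, hreach⟩ := h
  exact ⟨i, hi, exists_isActivePath_of_reachable
    (fun x y h1 h2 => lt_asymm (IsLineAncestor.lt h1) (IsLineAncestor.lt h2))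
    (by rintro rfl; exact hj hi) hs ht hreach⟩

lemma isActivePath_pair_of_isLineAncestor {i j : Fin d} (h : G.IsLineAncestor a i j) :
    IsActivePath (G.partialAncestorGraph a) a i j [i, j] :=
  ⟨⟨le_rfl, by simpa using h.lt.ne,
    by simpa using Or.inr (show (G.partialAncestorGraph a).Adj j i from h), rfl, rfl⟩, Or.inl rfl⟩

/-- Integrating out any set of nodes from the product of their own conditional densities gives
one: the least node is a parent of no other, so that it can be integrated out first. -/
lemma lmarginal_prod_eq_one (G : ParentGraph d) {𝓨 : Fin d → Type*}
    [∀ i, MeasurableSpace (𝓨 i)] {μ : ∀ i, Measure (𝓨 i)} [∀ i, SigmaFinite (μ i)]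
    {k : ∀ i, 𝓨 i → (∀ j : G.par i, 𝓨 j) → ℝ≥0∞}
    (hkm : ∀ i, Measurable fun y : ∀ i, 𝓨 i => k i (y i) ((G.par i).restrict y))
    (hk1 : ∀ i z, ∫⁻ x, k i x z ∂(μ i) = 1)
    (hkd : ∀ i, DependsOn (fun y : ∀ i, 𝓨 i => k i (y i) ((G.par i).restrict y))
      ↑(insert i (G.par i))) (N : Finset (Fin d)) :
    ∫⋯∫⁻_N, (fun y => ∏ i ∈ N, k i (y i) ((G.par i).restrict y)) ∂μ = fun _ => 1 := by
  induction N using Finset.induction_on_min with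
  | empty => simp
  | insert m N hm ih =>
    have hmN : m ∉ N := fun h => lt_irrefl _ (hm m h)
    have hsing : ∫⋯∫⁻_{m}, (fun y => ∏ i ∈ insert m N, k i (y i) ((G.par i).restrict y)) ∂μ
        = fun y => ∏ i ∈ N, k i (y i) ((G.par i).restrict y) := by
      simp only [Finset.prod_insert hmN, mul_comm (k m _ _)]
      rw [lmarginal_mul_of_dependsOn (t := Finset.univ.erase m) (by simp) _ (hkm m)]
      · ext y
        have hmp : m ∉ G.par m := fun h => lt_irrefl _ (G.lt_of_mem_par h)
        have hz : ∀ v, (G.par m).restrict (Function.update y m v) = (G.par m).restrict y :=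
          fun v => funext fun i => Function.update_of_ne (ne_of_mem_of_not_mem i.2 hmp) _ _
        rw [lmarginal_singleton]
        simp [hz, hk1]
      · refine DependsOn.finset_prod N fun i hi => (hkd i).mono fun j hj => ?_
        simp only [Finset.coe_insert, Set.mem_insert_iff, Finset.mem_coe] at hj
        simp only [Finset.coe_erase, Finset.coe_univ, Set.mem_sdiff, Set.mem_univ, true_and,
          Set.mem_singleton_iff]
        rintro rfl
        rcases hj with rfl | hj
        · exact hmN hi
        · exact lt_asymm (hm i hi) (G.lt_of_mem_par hj)
    have hunion := lmarginal_union' μ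
      (fun y => ∏ i ∈ insert m N, k i (y i) ((G.par i).restrict y))
      (Finset.measurable_prod _ fun i _ => hkm i) (Finset.disjoint_singleton_left.2 hmN)
    rwa [← Finset.insert_eq, hsing, ih] at hunion

end ParentGraph

theorem mainTheorem5 {d : ℕ} (G : ParentGraph d) (M α β C : Finset (Fin d))
    (hunion : M ∪ α ∪ β ∪ C = Finset.univ)
    (hMα : Disjoint M α) (hMβ : Disjoint M β) (hMC : Disjoint M C)
    (hαβ : Disjoint α β) (hαC : Disjoint α C) (hβC : Disjoint β C)
    (a : Set (Fin d)) (ha : a = ↑α ∪ ↑M)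
    (hsep : ¬ ∃ i ∈ α, ∃ j ∈ β, ∃ p : List (Fin d),
      IsActivePath (G.partialAncestorGraph a) a i j p)
    {𝓨 : Fin d → Type*} [∀ i, MeasurableSpace (𝓨 i)] [∀ i, StandardBorelSpace (𝓨 i)]
    (μ : ∀ i, Measure (𝓨 i)) [∀ i, SigmaFinite (μ i)]
    (f : (∀ i, 𝓨 i) → ℝ≥0∞) (hf : G.Factorizes μ f)
    (P : Measure (∀ i, 𝓨 i)) [IsProbabilityMeasure P]
    (hP : P = (Measure.pi μ).withDensity f) :
    CondIndepGiven P α β C := by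
  classical
  obtain ⟨k, hkm, hk1, hfk⟩ := hf
  -- The partition, as a case distinction in terms of `a`.
  have hcase : ∀ v, v ∈ M ∨ v ∈ α ∨ v ∈ β ∨ v ∈ C := fun v => by
    have := Finset.mem_univ v
    rw [← hunion] at this
    simpa [or_assoc] using this
  rw [Finset.disjoint_left] at hMα hMβ hMC hαβ hαC hβC
  have haα : ∀ {v}, v ∈ α → v ∈ a := fun h => by simp [ha, h]
  have haM : ∀ {v}, v ∈ M → v ∈ a := fun h => by simp [ha, h]
  have haβ : ∀ {v}, v ∈ β → v ∉ a := fun {v} h => by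
    simp only [ha, Set.mem_union, Finset.mem_coe, not_or]
    exact ⟨fun h' => hαβ h' h, fun h' => hMβ h' h⟩
  have haC : ∀ {v}, v ∈ C → v ∉ a := fun {v} h => by
    simp only [ha, Set.mem_union, Finset.mem_coe, not_or]
    exact ⟨fun h' => hαC h' h, fun h' => hMC h' h⟩
  have hacase : ∀ {v}, v ∈ a → v ∈ α ∨ v ∈ M := fun h => by simpa [ha] using h
  let R := G.IsConnectedTo a α
  have hRiff : ∀ {s t}, s ∈ a → t ∉ a → G.IsLineAncestor a t s → (R s ↔ R t) :=
    ParentGraph.isConnectedTo_iff_of_isLineAncestor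
  have hRα : ∀ {i}, i ∈ α → R i := ParentGraph.isConnectedTo_self
  have hRβ : ∀ {j}, j ∈ β → ¬ R j := fun {j} hj h => hsep (by
    obtain ⟨i, hi, hp⟩ := ParentGraph.exists_isActivePath_of_isConnectedTo h
      (fun h' => hαβ h' hj) (Or.inl rfl)
    exact ⟨i, hi, j, hj, hp⟩)
  have hβR : ∀ {j t}, j ∈ β → t ∉ a → G.IsLineAncestor a t j → ¬ R t :=
    fun {j t} hj ht hjt h => hsep (by
      obtain ⟨i, hi, hp⟩ := ParentGraph.exists_isActivePath_of_isConnectedTo h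
        (fun h' => hαβ h' hj) (Or.inr ⟨ht, hjt⟩)
      exact ⟨i, hi, j, hj, hp⟩)
  have hβα : ∀ {i j}, i ∈ α → j ∈ β → ¬ G.IsLineAncestor a i j := fun hi hj h =>
    hsep ⟨_, hi, _, hj, _, ParentGraph.isActivePath_pair_of_isLineAncestor h⟩
  -- `N` consists of the nodes of `M` without a descendant outside `M`. Among the other nodes, `S`
  -- collects those of `a` that are connected to `α`, and `T` those of `a ∪ β` that are not.
  let N : Finset (Fin d) := {m ∈ M | ∀ t, t ∉ M → ¬ G.IsLineAncestor a t m}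
  let S : Finset (Fin d) := {s | s ∈ a ∧ s ∉ N ∧ R s}
  let T : Finset (Fin d) := {s | s ∉ C ∧ s ∉ N ∧ ¬ R s}
  have hmN : ∀ {m}, m ∈ N ↔ m ∈ M ∧ ∀ t, t ∉ M → ¬ G.IsLineAncestor a t m := by simp [N]
  have hmS : ∀ {s}, s ∈ S ↔ s ∈ a ∧ s ∉ N ∧ R s := by simp [S]
  have hmT : ∀ {s}, s ∈ T ↔ s ∉ C ∧ s ∉ N ∧ ¬ R s := by simp [T]
  have hNM : ∀ {m}, m ∈ N → m ∈ M := fun h => (hmN.1 h).1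
  -- `N` is closed under children.
  have hNpar : ∀ {i p}, p ∈ G.par i → p ∈ N → i ∈ N := fun {i p} hp hpN => by
    rw [hmN] at hpN ⊢
    have hiM : i ∈ M := by
      by_contra h
      exact hpN.2 i h (.parent hp)
    exact ⟨hiM, fun t ht h => hpN.2 t ht (h.of_mem_par (haM hiM) hp)⟩
  have hβa : ∀ {v}, v ∉ C → v ∈ a ∨ v ∈ β := fun {v} hv => by
    rcases hcase v with h | h | h | h
    exacts [Or.inl (haM h), Or.inl (haα h), Or.inr h, absurd h hv]
  -- The parents of a node outside `N` are on the same side as the node.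
  have hpar : ∀ {i p}, i ∉ N → p ∈ G.par i → p ∉ C → (p ∈ a ∧ R p ∧ R i) ∨ (¬ R p ∧ ¬ R i) := by
    intro i p hi hp hpC
    -- It suffices to compare both with a node outside `M` of which both are line ancestors.
    have main : ∀ t, t ∉ M → G.IsLineAncestor a t p →
        (p ∈ a ∧ R p ∧ R t) ∨ (¬ R p ∧ ¬ R t) := by
      intro t ht htp
      rcases hβa hpC with hpa | hpβ
      · rcases hcase t with h | h | h | h
        · exact absurd h ht
        · exact Or.inl ⟨hpa, ParentGraph.isConnectedTo_of_isLineAncestor hpa h htp, hRα h⟩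
        all_goals
          have h' : t ∉ a := by first | exact haβ h | exact haC h
          have := hRiff hpa h' htp
          by_cases hR : R p
          · exact Or.inl ⟨hpa, hR, this.1 hR⟩
          · exact Or.inr ⟨hR, fun h => hR (this.2 h)⟩
      · refine Or.inr ⟨hRβ hpβ, ?_⟩
        by_cases hta : t ∈ a
        · rcases hacase hta with h | h
          · exact absurd htp (hβα h hpβ)
          · exact absurd h ht
        · exact hβR hpβ hta htp
    by_cases hiM : i ∈ M
    · have hia := haM hiM
      obtain ⟨t, ht, hti⟩ : ∃ t, t ∉ M ∧ G.IsLineAncestor a t i := by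
        by_contra! h
        exact hi (hmN.2 ⟨hiM, h⟩)
      have hRi : R i ↔ R t := by
        rcases hcase t with h | h | h | h
        · exact absurd h ht
        · exact iff_of_true (ParentGraph.isConnectedTo_of_isLineAncestor hia h hti) (hRα h)
        · exact hRiff hia (haβ h) hti
        · exact hRiff hia (haC h) hti
      rw [hRi]
      exact main t ht (hti.of_mem_par hia hp)
    · exact main i hiM (.parent hp)
  -- Each factor outside `N` depends on `S ∪ C` or on `T ∪ C` only.
  let F : Fin d → (∀ i, 𝓨 i) → ℝ≥0∞ := fun i y => k i (y i) ((G.par i).restrict y)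
  have hFm : ∀ i, Measurable (F i) := fun i =>
    (hkm i).comp ((measurable_pi_apply i).prodMk (Finset.measurable_restrict _))
  have hFd : ∀ i, DependsOn (F i) ↑(insert i (G.par i)) := fun i y z h => by
    have h1 : y i = z i := h i (by simp)
    have h2 : (G.par i).restrict y = (G.par i).restrict z :=
      funext fun j => h j (by simp)
    simp only [F, h1, h2]
  have hFS : ∀ i, i ∉ N → R i → DependsOn (F i) ↑(S ∪ C) := fun i hi hR => by
    refine (hFd i).mono fun v hv => ?_
    simp only [Finset.coe_insert, Set.mem_insert_iff, Finset.mem_coe] at hv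
    simp only [Finset.coe_union, Set.mem_union, Finset.mem_coe, hmS]
    by_cases hvC : v ∈ C
    · exact Or.inr hvC
    refine Or.inl ?_
    rcases hv with rfl | hv
    · exact ⟨(hβa hvC).resolve_right fun h => hRβ h hR, hi, hR⟩
    · rcases hpar hi hv hvC with h | h
      · exact ⟨h.1, fun h' => hi (hNpar hv h'), h.2.1⟩
      · exact absurd hR h.2
  have hFT : ∀ i, i ∉ N → ¬ R i → DependsOn (F i) ↑(T ∪ C) := fun i hi hR => by
    refine (hFd i).mono fun v hv => ?_
    simp only [Finset.coe_insert, Set.mem_insert_iff, Finset.mem_coe] at hv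
    simp only [Finset.coe_union, Set.mem_union, Finset.mem_coe, hmT]
    by_cases hvC : v ∈ C
    · exact Or.inr hvC
    refine Or.inl ⟨hvC, ?_⟩
    rcases hv with rfl | hv
    · exact ⟨hi, hR⟩
    · rcases hpar hi hv hvC with h | h
      · exact absurd h.2.2 hR
      · exact ⟨fun h' => hi (hNpar hv h'), h.1⟩
  have hNα : ∀ {i}, i ∈ N → i ∉ α := fun h h' => hMα (hNM h) h'
  refine condIndepGiven_of_eq_mul_mul (μ := μ) (S := S) (T := T) (N := N)
    (Φ := fun y => ∏ i with i ∉ N ∧ R i, F i y) (Ψ := fun y => ∏ i with i ∉ N ∧ ¬ R i, F i y)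
    (Ω := fun y => ∏ i ∈ N, F i y) ?_ ?_ ?_ ?_ ?_ ?_ ?_ ?_ ?_ ?_ ?_ ?_ P ?_
  · ext v
    simp only [Finset.mem_union, hmS, hmT, Finset.mem_univ, iff_true]
    by_cases hvC : v ∈ C
    · exact Or.inl hvC
    by_cases hvN : v ∈ N
    · exact Or.inr (Or.inr (Or.inr hvN))
    by_cases hR : R v
    · exact Or.inr (Or.inr (Or.inl
        ⟨(hβa hvC).resolve_right fun h => hRβ h hR, hvN, hR⟩))
    · exact Or.inr (Or.inl ⟨hvC, hvN, hR⟩)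
  · exact Finset.disjoint_left.2 fun v h => (hmS.1 h).2.1
  · refine Finset.disjoint_left.2 fun v h h' => ?_
    rcases Finset.mem_union.1 h' with h' | h'
    · exact (hmT.1 h).2.2 (hmS.1 h').2.2
    · exact (hmT.1 h).2.1 h'
  · refine Finset.disjoint_left.2 fun v h h' => ?_
    simp only [Finset.mem_union, hmS, hmT] at h'
    rcases h' with h' | h' | h'
    · exact h'.1 h
    · exact haC h h'.1
    · exact hMC (hNM h') h
  · exact fun v hv => hmS.2 ⟨haα hv, fun h => hNα h hv, hRα hv⟩
  · exact fun v hv => hmT.2 ⟨hβC hv, fun h => hMβ (hNM h) hv, hRβ hv⟩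
  · exact DependsOn.finset_prod _ fun i hi => by
      simp only [Finset.mem_filter] at hi; exact hFS i hi.2.1 hi.2.2
  · exact DependsOn.finset_prod _ fun i hi => by
      simp only [Finset.mem_filter] at hi; exact hFT i hi.2.1 hi.2.2
  · exact Finset.measurable_prod _ fun i _ => hFm i
  · exact Finset.measurable_prod _ fun i _ => hFm i
  · exact Finset.measurable_prod _ fun i _ => hFm i
  · exact fun x => congrFun (G.lmarginal_prod_eq_one hFm hk1 hFd N) x
  · rw [hP]
    congr 1
    ext y
    rw [hfk y, ← Finset.prod_filter_mul_prod_filter_not Finset.univ (· ∈ N), mul_comm]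
    congr 1
    · rw [← Finset.prod_filter_mul_prod_filter_not (Finset.univ.filter (· ∉ N)) R]
      simp only [Finset.filter_filter, F]
    · simp [F]
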